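/- Let $N\in\mathbb N$ and let $\mathcal G$ be a weighted directed graph on the nodes $\{1,\dots,N\}$ without self-loops, with edge set $\mathcal E$ and adjacency matrix $A\in\mathbb R_{\ge 0}^{N\times N}$, where $A_{ij}>0$ if $(j,i)\in\mathcal E$ and $A_{ij}=0$ otherwise. Let $L=\operatorname{diag}(A\mathbf 1)-A$ be its Laplacian. Let $\Delta>0$, let $q(z)=\left\lfloor \frac z\Delta+\frac12\right\rfloor\Delta$ for $z\in\mathbb R$ be the uniform quantizer with step $\Delta$, and put $q(x)=(q(x_1),\dots,q(x_N))$ for $x\in\mathbb R^N$. For $x\in\mathbb R^N$ let $$\mathcal K(-Lq(x))=\bigcap_{\delta>0}\overline{\mathrm{co}}\,\bigl(-Lq(B(x,\delta))\bigr),$$ where $B(x,\delta)$ is the Euclidean ball of radius $\delta$ centered at $x$ and $\overline{\mathrm{co}}$ denotes the closed convex hull. A (complete) Krasowskii solution of $\dot x=-Lq(x)$ is a function $x:[0,\infty)\to\mathbb R^N$ that is absolutely continuous on compact intervals and satisfies $\dot x(t)\in\mathcal K(-Lq(x(t)))$ for almost every $t\ge 0$. Let $$\mathcal D=\{x\in\mathbb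 R^N:\ \exists k\in\mathbb Z\ \text{such that}\ q(x_i)=\Delta k\ \text{for all } i\in\{1,\dots,N\}\},$$ a set that depends only on $N$ and on the quantizer step $\Delta$, and not on the graph. **Theorem (Convergence to equilibria).** Assume that $\mathcal G$ is symmetric ($A=A^{\mathsf T}$) and connected (any two nodes are joined by a path). If $x(t)$ is any complete Krasowskii solution of $\dot x=-Lq(x)$, then $$\operatorname{dist}(x(t),\mathcal D)\to 0\qquad\text{as } t\to\infty,$$ where $\operatorname{dist}$ is the Euclidean distance from a point to a set. -/

import Mathlib

open Filter Topology MeasureTheory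

noncomputable section

namespace QuantizedConsensus

/-- A weighted directed graph on the nodes `Fin N` without self-loops: an edge set and a weight
matrix `A` with nonnegative entries such that `A i j > 0` if `(j, i)` is an edge and `A i j = 0`
otherwise. -/
structure WeightedGraph (N : ℕ) where
  edges : Set (Fin N × Fin N)
  A : Matrix (Fin N) (Fin N) ℝ
  adj_pos : ∀ i j, (j, i) ∈ edges → 0 < A i j
  adj_zero : ∀ i j, (j, i) ∉ edges → A i j = 0
  no_loop : ∀ i, (i, i) ∉ edges

namespace WeightedGraph

variable {N : ℕ}

/-- The graph is symmetric if its weight matrix is. -/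
def IsSymmetric (G : WeightedGraph N) : Prop := G.A.IsSymm

/-- Any two nodes are joined by a path, the orientation of the edges being ignored. For a symmetric
graph this is the same as strong connectedness. -/
def IsConnected (G : WeightedGraph N) : Prop :=
  ∀ i j, Relation.ReflTransGen (fun u v => (u, v) ∈ G.edges ∨ (v, u) ∈ G.edges) i j

/-- The Laplacian `L = diag(A 1) - A`. -/
def laplacian (G : WeightedGraph N) : Matrix (Fin N) (Fin N) ℝ :=
  Matrix.diagonal (G.A.mulVec 1) - G.A

end WeightedGraph

/-- The uniform quantizer with step `Δ`: `q(z) = ⌊z / Δ + 1 / 2⌋ Δ`. -/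
def quantizer (Δ z : ℝ) : ℝ := (⌊z / Δ + 1 / 2⌋ : ℝ) * Δ

/-- The quantized right-hand side `x ↦ -L q(x)`, with `q` acting componentwise. -/
def quantizedField {N : ℕ} (G : WeightedGraph N) (Δ : ℝ) (x : EuclideanSpace ℝ (Fin N)) :
    EuclideanSpace ℝ (Fin N) :=
  WithLp.toLp 2 (-(G.laplacian.mulVec fun i => quantizer Δ (x i)))

/-- The Krasowskii regularization of a vector field `f`:
`K f (x) = ⋂_{δ > 0} closure (co f(B(x, δ)))`. -/
def krasowskii {E : Type*} [NormedAddCommGroup E] [NormedSpace ℝ E] (f : E → E) (x : E) : Set E :=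
  ⋂ δ : ℝ, ⋂ _ : 0 < δ, closure (convexHull ℝ (f '' Metric.ball x δ))

/-- `x` is a Krasowskii solution of `ẋ = f(x)` on the interval `I`: it is absolutely continuous on
every compact subinterval of `I`, and at almost every `t ∈ I` it has a derivative, which lies in
`K f (x t)`. -/
structure IsKrasowskiiSolution {E : Type*} [NormedAddCommGroup E] [NormedSpace ℝ E]
    (f : E → E) (I : Set ℝ) (x : ℝ → E) : Prop where
  absolutelyContinuous : ∀ a ∈ I, ∀ b ∈ I, AbsolutelyContinuousOnInterval x a b
  inclusion : ∀ᵐ t ∂(volume.restrict I), ∃ v ∈ krasowskii f (x t), HasDerivAt x v t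

/-- The set `𝓓` of the states all of whose components have the same quantized value. -/
def consensusSet (N : ℕ) (Δ : ℝ) : Set (EuclideanSpace ℝ (Fin N)) :=
  {x | ∃ k : ℤ, ∀ i, quantizer Δ (x i) = Δ * k}

end QuantizedConsensus

end

open Filter Topology MeasureTheory

noncomputable section

/-! A solution moves with velocity `-L p`, where each `p i` lies between the one-sided limits of `q`
at `x i` (`exists_of_mem_krasowskii`). These intervals, shifted by `k Δ`, are subdifferentials of a
convex potential; let `V_k` be its sum over the nodes. Using `p` both as velocity and as
subgradient, symmetry gives `V_k' = -(1/2) ∑ A i j (p i - p j)²` almost everywhere.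

If all `p i - p j < Δ`, the state lies in a closed cube of side `Δ` about some `k Δ 1`, which is the
zero set of `V_k`. Otherwise connectedness bounds `V_0'` above by a negative constant. As `V_0 ≥ 0`,
some cube is reached in finite time; its own `V_k` then stays zero, and the cube lies in the closure
of `𝓓`. -/

/-- The composition of a function Lipschitz on a set with an absolutely continuous function taking
values in that set is absolutely continuous. -/
theorem LipschitzOnWith.comp_absolutelyContinuousOnInterval {X Y : Type*} [PseudoMetricSpace X]
    [PseudoMetricSpace Y] {g : X → Y} {s : Set X} {K : NNReal} {f : ℝ → X} {a b : ℝ}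
    (hg : LipschitzOnWith K g s) (hf : AbsolutelyContinuousOnInterval f a b)
    (hfs : Set.MapsTo f (Set.uIcc a b) s) :
    AbsolutelyContinuousOnInterval (g ∘ f) a b := by
  refine squeeze_zero' (.of_forall fun E => Finset.sum_nonneg fun _ _ => dist_nonneg) ?_
    (by simpa using Tendsto.const_mul (K : ℝ) hf)
  filter_upwards [mem_inf_of_right (mem_principal_self _)] with E hE
  rw [Finset.mul_sum]
  exact Finset.sum_le_sum fun i hi =>
    hg.dist_le_mul _ (hfs (hE.1 i hi).1) _ (hfs (hE.1 i hi).2)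

/-- An absolutely continuous function whose derivative is almost everywhere at most `c` grows at
rate at most `c`. -/
theorem AbsolutelyContinuousOnInterval.sub_le_of_ae_deriv_le {f : ℝ → ℝ} {a b c : ℝ} (hab : a ≤ b)
    (hf : AbsolutelyContinuousOnInterval f a b)
    (hc : ∀ᵐ t, t ∈ Set.Icc a b → deriv f t ≤ c) : f b - f a ≤ c * (b - a) := by
  rw [← hf.integral_deriv_eq_sub]
  calc ∫ t in a..b, deriv f t ≤ ∫ _ in a..b, c := by
        refine intervalIntegral.integral_mono_ae_restrict hab hf.intervalIntegrable_deriv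
          intervalIntegrable_const ?_
        exact (ae_restrict_iff' measurableSet_Icc).2 hc
    _ = c * (b - a) := by simp [mul_comm]

/-- If `p` is a subgradient of `V` at `x t`, then the chain rule `(V ∘ x)' = p · x'` holds at `t`
as soon as both derivatives exist. -/
theorem deriv_comp_eq_of_subgradient {E : Type*} [NormedAddCommGroup E] [NormedSpace ℝ E]
    {V : E → ℝ} {x : ℝ → E} {v : E} {t : ℝ} (p : E →L[ℝ] ℝ)
    (hp : ∀ y, V (x t) + p (y - x t) ≤ V y) (hx : HasDerivAt x v t)
    (hV : DifferentiableAt ℝ (V ∘ x) t) : deriv (V ∘ x) t = p v := by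
  have h1 : HasDerivAt (fun s => (V ∘ x) s - p (x s)) (deriv (V ∘ x) t - p v) t :=
    hV.hasDerivAt.sub (p.hasFDerivAt.comp_hasDerivAt t hx)
  -- `V` may have a kink at `x t`; a minimum at the interior time `t` still forces equality.
  have h2 : IsLocalMin (fun s => (V ∘ x) s - p (x s)) t := by
    refine Eventually.of_forall fun s => ?_
    have := hp (x s)
    rw [map_sub] at this
    simp only [Function.comp_apply]
    linarith
  have := h2.hasDerivAt_eq_zero h1
  linarith

namespace QuantizedConsensus

/-! ### The quantizer and its convex potential -/

section Quantizer

variable {Δ : ℝ}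

/-- The left limit of the quantizer. -/
def lowerQuantizer (Δ z : ℝ) : ℝ := (⌈z / Δ - 1 / 2⌉ : ℝ) * Δ

theorem abs_sub_quantizer_le (hΔ : 0 < Δ) (z : ℝ) : |z - quantizer Δ z| ≤ Δ / 2 := by
  have h1 := Int.floor_le (z / Δ + 1 / 2)
  have h2 := (Int.lt_floor_add_one (z / Δ + 1 / 2)).le
  have hz : z = z / Δ * Δ := by field_simp
  have := mul_le_mul_of_nonneg_right h1 hΔ.le
  have := mul_le_mul_of_nonneg_right h2 hΔ.le
  rw [abs_le, quantizer]
  constructor <;> linarith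

theorem abs_sub_lowerQuantizer_le (hΔ : 0 < Δ) (z : ℝ) : |z - lowerQuantizer Δ z| ≤ Δ / 2 := by
  have h1 := Int.le_ceil (z / Δ - 1 / 2)
  have h2 := (Int.ceil_lt_add_one (z / Δ - 1 / 2)).le
  have hz : z = z / Δ * Δ := by field_simp
  have := mul_le_mul_of_nonneg_right h1 hΔ.le
  have := mul_le_mul_of_nonneg_right h2 hΔ.le
  rw [abs_le, lowerQuantizer]
  constructor <;> linarith

/-- Near `z`, the quantizer takes values between its one-sided limits at `z`. -/
theorem eventually_quantizer_mem_Icc (hΔ : 0 < Δ) (z : ℝ) :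
    ∀ᶠ y in 𝓝 z, quantizer Δ y ∈ Set.Icc (lowerQuantizer Δ z) (quantizer Δ z) := by
  have hcont : Tendsto (fun y : ℝ => y / Δ + 1 / 2) (𝓝 z) (𝓝 (z / Δ + 1 / 2)) :=
    Continuous.tendsto (by fun_prop) z
  have h1 := hcont.eventually_lt_const (Int.lt_floor_add_one (z / Δ + 1 / 2))
  have h2 : (⌈z / Δ - 1 / 2⌉ : ℝ) < z / Δ + 1 / 2 := by
    linarith [Int.ceil_lt_add_one (z / Δ - 1 / 2)]
  filter_upwards [h1, hcont.eventually_const_lt h2] with y hy1 hy2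
  have h3 : ⌊y / Δ + 1 / 2⌋ ≤ ⌊z / Δ + 1 / 2⌋ :=
    Int.lt_add_one_iff.1 (Int.floor_lt.2 (by exact_mod_cast hy1))
  have h4 : ⌈z / Δ - 1 / 2⌉ ≤ ⌊y / Δ + 1 / 2⌋ := Int.le_floor.2 hy2.le
  exact ⟨mul_le_mul_of_nonneg_right (by exact_mod_cast h4) hΔ.le,
    mul_le_mul_of_nonneg_right (by exact_mod_cast h3) hΔ.le⟩

/-- Multiples of `Δ` at distance at most `Δ / 2` are nearest multiples. -/
theorem sq_sub_le_of_abs_sub_le {z : ℝ} {n : ℤ} (hn : |z - n * Δ| ≤ Δ / 2) (m : ℤ) :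
    (z - n * Δ) ^ 2 ≤ (z - m * Δ) ^ 2 := by
  obtain rfl | hmn := eq_or_ne m n
  · rfl
  have h1 : (1 : ℝ) ≤ |(m : ℝ) - n| := by exact_mod_cast Int.one_le_abs (sub_ne_zero.2 hmn)
  have hΔ : 0 ≤ Δ := by linarith [abs_nonneg (z - n * Δ)]
  have h2 : Δ ≤ |((m : ℝ) - n) * Δ| := by
    rw [abs_mul, abs_of_nonneg hΔ]
    exact le_mul_of_one_le_left hΔ h1
  have h3 : |((m : ℝ) - n) * Δ| ≤ |z - n * Δ| + |z - m * Δ| := by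
    rw [show ((m : ℝ) - n) * Δ = (z - n * Δ) - (z - m * Δ) by ring]
    exact abs_sub _ _
  exact sq_le_sq.2 (by linarith)

/-- The convex potential whose subdifferential is `[q(z-), q(z+)] - k Δ`. -/
def potential (Δ : ℝ) (k : ℤ) (z : ℝ) : ℝ := ((z - k * Δ) ^ 2 - (z - quantizer Δ z) ^ 2) / 2

theorem potential_nonneg (hΔ : 0 < Δ) (k : ℤ) (z : ℝ) : 0 ≤ potential Δ k z := by
  have := sq_sub_le_of_abs_sub_le (abs_sub_quantizer_le hΔ z) k
  rw [potential, quantizer]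
  linarith

theorem potential_eq_zero_iff (hΔ : 0 < Δ) {k : ℤ} {z : ℝ} :
    potential Δ k z = 0 ↔ |z - k * Δ| ≤ Δ / 2 := by
  constructor
  · intro h
    have : (z - k * Δ) ^ 2 = (z - quantizer Δ z) ^ 2 := by rw [potential] at h; linarith
    rw [(sq_eq_sq_iff_abs_eq_abs _ _).1 this]
    exact abs_sub_quantizer_le hΔ z
  · intro h
    have h1 := sq_sub_le_of_abs_sub_le h ⌊z / Δ + 1 / 2⌋
    have h2 := potential_nonneg hΔ k z
    rw [potential, quantizer] at *
    linarith

/-- The squares of `z` cancel: the potential is the maximum over `n` of affine functions of slope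
`(n - k) Δ`, attained at the nearest multiples `n Δ`. -/
theorem potential_add_mul_le_of_abs_sub_le (hΔ : 0 < Δ) (k : ℤ) {z : ℝ} {n : ℤ}
    (hn : |z - n * Δ| ≤ Δ / 2) (w : ℝ) :
    potential Δ k z + (n * Δ - k * Δ) * (w - z) ≤ potential Δ k w := by
  have h1 := sq_sub_le_of_abs_sub_le hn ⌊z / Δ + 1 / 2⌋
  have h2 := sq_sub_le_of_abs_sub_le (abs_sub_quantizer_le hΔ w) n
  simp only [potential, quantizer] at *
  linarith

/-- The left side is affine in `p`, so the two endpoints suffice. -/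
theorem potential_add_mul_le (hΔ : 0 < Δ) (k : ℤ) {z p : ℝ}
    (hp : p ∈ Set.Icc (lowerQuantizer Δ z) (quantizer Δ z)) (w : ℝ) :
    potential Δ k z + (p - k * Δ) * (w - z) ≤ potential Δ k w := by
  have h1 := potential_add_mul_le_of_abs_sub_le hΔ k (abs_sub_quantizer_le hΔ z) w
  have h2 := potential_add_mul_le_of_abs_sub_le hΔ k (abs_sub_lowerQuantizer_le hΔ z) w
  obtain h | h := le_total 0 (w - z)
  · have := mul_le_mul_of_nonneg_right hp.2 h
    rw [quantizer] at this
    linarith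
  · have := mul_le_mul_of_nonpos_right hp.1 h
    rw [lowerQuantizer] at this
    linarith

theorem lowerQuantizer_le_quantizer (hΔ : 0 < Δ) (z : ℝ) :
    lowerQuantizer Δ z ≤ quantizer Δ z :=
  have h := (eventually_quantizer_mem_Icc hΔ z).self_of_nhds
  h.1

theorem abs_potential_sub_le (hΔ : 0 < Δ) (k : ℤ) {R z w : ℝ} (hz : |z| ≤ R) (hw : |w| ≤ R) :
    |potential Δ k w - potential Δ k z| ≤ (R + Δ / 2 + |k * Δ|) * |w - z| := by
  have hq : ∀ y : ℝ, |y| ≤ R → |quantizer Δ y - k * Δ| ≤ R + Δ / 2 + |k * Δ| := by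
    intro y hy
    have h1 := abs_le.1 (abs_sub_quantizer_le hΔ y)
    have h2 := abs_le.1 hy
    have h3 := abs_le.1 (le_refl |k * Δ|)
    rw [abs_le]
    constructor <;> linarith
  have key : ∀ y y' : ℝ, |y| ≤ R →
      potential Δ k y - potential Δ k y' ≤ (R + Δ / 2 + |k * Δ|) * |y - y'| := by
    intro y y' hy
    have h1 := potential_add_mul_le hΔ k ⟨lowerQuantizer_le_quantizer hΔ y, le_rfl⟩ y'
    have h2 : (quantizer Δ y - k * Δ) * (y - y') ≤ (R + Δ / 2 + |k * Δ|) * |y - y'| := by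
      refine (le_abs_self _).trans ?_
      rw [abs_mul]
      exact mul_le_mul_of_nonneg_right (hq y hy) (abs_nonneg _)
    linarith
  rw [abs_le]
  have h1 := key w z hw
  have h2 := key z w hz
  rw [abs_sub_comm] at h2
  constructor <;> linarith

end Quantizer

/-! ### Lyapunov functions and closed cubes around consensus -/

section Lyapunov

variable {N : ℕ} {Δ : ℝ}

/-- The Lyapunov function: the sum of the potentials of the components. -/
def lyapunov (Δ : ℝ) (k : ℤ) (x : EuclideanSpace ℝ (Fin N)) : ℝ := ∑ i, potential Δ k (x i)

theorem lyapunov_nonneg (hΔ : 0 < Δ) (k : ℤ) (x : EuclideanSpace ℝ (Fin N)) :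
    0 ≤ lyapunov Δ k x := Finset.sum_nonneg fun _ _ => potential_nonneg hΔ k _

theorem lyapunov_eq_zero_iff (hΔ : 0 < Δ) {k : ℤ} {x : EuclideanSpace ℝ (Fin N)} :
    lyapunov Δ k x = 0 ↔ ∀ i, |x i - k * Δ| ≤ Δ / 2 := by
  rw [lyapunov, Finset.sum_eq_zero_iff_of_nonneg fun _ _ => potential_nonneg hΔ k _]
  simp [potential_eq_zero_iff hΔ]

theorem lipschitzOnWith_lyapunov (hΔ : 0 < Δ) (k : ℤ) (R : ℝ) :
    ∃ K, LipschitzOnWith K (lyapunov (N := N) Δ k) (Metric.closedBall 0 R) := by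
  refine ⟨Real.toNNReal (N * (R + Δ / 2 + |k * Δ|)), LipschitzOnWith.of_dist_le' ?_⟩
  intro y hy z hz
  rw [mem_closedBall_zero_iff] at hy hz
  have hR : 0 ≤ R := (norm_nonneg y).trans hy
  have hcoord : ∀ (w : EuclideanSpace ℝ (Fin N)) i, |w i| ≤ ‖w‖ := fun w i =>
    PiLp.norm_apply_le w i
  rw [Real.dist_eq, lyapunov, lyapunov, ← Finset.sum_sub_distrib, dist_eq_norm]
  calc |∑ i, (potential Δ k (y i) - potential Δ k (z i))|
      ≤ ∑ i, |potential Δ k (y i) - potential Δ k (z i)| := Finset.abs_sum_le_sum_abs _ _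
    _ ≤ ∑ _i : Fin N, (R + Δ / 2 + |k * Δ|) * ‖y - z‖ := by
        refine Finset.sum_le_sum fun i _ => ?_
        refine (abs_potential_sub_le hΔ k ((hcoord z i).trans hz) ((hcoord y i).trans hy)).trans ?_
        exact mul_le_mul_of_nonneg_left (hcoord (y - z) i) (by positivity)
    _ = N * (R + Δ / 2 + |k * Δ|) * ‖y - z‖ := by simp [mul_assoc]

theorem absolutelyContinuousOnInterval_lyapunov (hΔ : 0 < Δ) (k : ℤ)
    {x : ℝ → EuclideanSpace ℝ (Fin N)} {a b : ℝ} (hx : AbsolutelyContinuousOnInterval x a b) :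
    AbsolutelyContinuousOnInterval (lyapunov Δ k ∘ x) a b := by
  obtain ⟨R, hR⟩ := hx.exists_bound
  obtain ⟨K, hK⟩ := lipschitzOnWith_lyapunov (N := N) hΔ k R
  exact hK.comp_absolutelyContinuousOnInterval hx fun t ht => mem_closedBall_zero_iff.2 (hR t ht)

/-- The states whose components all lie between the one-sided limits of the quantizer. -/
def quantizerBox (Δ : ℝ) (x : EuclideanSpace ℝ (Fin N)) : Set (Fin N → ℝ) :=
  Set.Icc (fun i => lowerQuantizer Δ (x i)) (fun i => quantizer Δ (x i))

/-- If the components of a selection of the quantized state differ by less than `Δ`, the state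
lies in a closed cube around a consensus value. -/
theorem exists_forall_abs_sub_le (hΔ : 0 < Δ) {x : EuclideanSpace ℝ (Fin N)} {p : Fin N → ℝ}
    (hp : p ∈ quantizerBox Δ x) (hpp : ∀ i j, p i - p j < Δ) :
    ∃ k : ℤ, ∀ i, |x i - k * Δ| ≤ Δ / 2 := by
  obtain hN | hN := isEmpty_or_nonempty (Fin N)
  · exact ⟨0, fun i => hN.elim i⟩
  -- The quantized minimal component gives `k`. Lower bounds are then immediate; upper bounds hold
  -- because multiples of `Δ` satisfying `m < n + Δ` satisfy `m ≤ n`.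
  obtain ⟨a, ha⟩ := Finite.exists_min fun i => x i
  refine ⟨⌊x a / Δ + 1 / 2⌋, fun i => ?_⟩
  have h1 : lowerQuantizer Δ (x i) < quantizer Δ (x a) + Δ := by
    linarith [hp.1 i, hp.2 a, hpp i a]
  have h2 : ⌈x i / Δ - 1 / 2⌉ ≤ ⌊x a / Δ + 1 / 2⌋ := by
    have : (⌈x i / Δ - 1 / 2⌉ : ℝ) < ⌊x a / Δ + 1 / 2⌋ + 1 := by
      refine lt_of_mul_lt_mul_right ?_ hΔ.le
      rw [lowerQuantizer, quantizer] at h1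
      linarith
    refine Int.lt_add_one_iff.1 ((Int.cast_lt (R := ℝ)).1 ?_)
    rwa [Int.cast_add, Int.cast_one]
  have h3 : lowerQuantizer Δ (x i) ≤ ⌊x a / Δ + 1 / 2⌋ * Δ :=
    mul_le_mul_of_nonneg_right (Int.cast_le.2 h2) hΔ.le
  have h4 := abs_le.1 (abs_sub_lowerQuantizer_le hΔ (x i))
  have h5 := abs_le.1 (abs_sub_quantizer_le hΔ (x a))
  rw [quantizer] at h5
  have := ha i
  rw [abs_le]
  constructor <;> linarith

theorem quantizer_eq_of_abs_sub_lt (hΔ : 0 < Δ) {k : ℤ} {z : ℝ} (h : |z - k * Δ| < Δ / 2) :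
    quantizer Δ z = Δ * k := by
  have hz : z = z / Δ * Δ := by field_simp
  obtain ⟨h1, h2⟩ := abs_lt.1 h
  have : ⌊z / Δ + 1 / 2⌋ = k := by
    rw [Int.floor_eq_iff]
    constructor
    · refine le_of_mul_le_mul_right ?_ hΔ
      linarith
    · refine lt_of_mul_lt_mul_right ?_ hΔ.le
      linarith
  rw [quantizer, this, mul_comm]

/-- Upper faces of the cube round up, hence the closure; shrinking towards the center enters the
open cube. -/
theorem mem_closure_consensusSet (hΔ : 0 < Δ) {k : ℤ} {x : EuclideanSpace ℝ (Fin N)}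
    (hx : ∀ i, |x i - k * Δ| ≤ Δ / 2) : x ∈ closure (consensusSet N Δ) := by
  let c : EuclideanSpace ℝ (Fin N) := WithLp.toLp 2 fun _ => k * Δ
  have hlim : Tendsto (fun s : ℝ => c + s • (x - c)) (𝓝[<] 1) (𝓝 x) := by
    have : Tendsto (fun s : ℝ => c + s • (x - c)) (𝓝 1) (𝓝 (c + (1 : ℝ) • (x - c))) :=
      Continuous.tendsto (by fun_prop) 1
    rw [one_smul, add_sub_cancel] at this
    exact this.mono_left nhdsWithin_le_nhds
  refine mem_closure_of_tendsto hlim ?_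
  filter_upwards [Ioo_mem_nhdsLT (zero_lt_one (α := ℝ))] with s hs
  refine ⟨k, fun i => quantizer_eq_of_abs_sub_lt hΔ ?_⟩
  have : (c + s • (x - c)) i - k * Δ = s * (x i - k * Δ) := by simp [c]
  rw [this, abs_mul, abs_of_pos hs.1]
  calc s * |x i - k * Δ| ≤ s * (Δ / 2) := mul_le_mul_of_nonneg_left (hx i) hs.1.le
    _ < Δ / 2 := mul_lt_of_lt_one_left (by positivity) hs.2

end Lyapunov

/-! ### Dirichlet form, Poincaré inequality and Krasowskii set -/

section Graph

variable {N : ℕ} {G : WeightedGraph N} {Δ : ℝ}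

theorem WeightedGraph.adj_nonneg (G : WeightedGraph N) (i j : Fin N) : 0 ≤ G.A i j := by
  by_cases h : (j, i) ∈ G.edges
  · exact (G.adj_pos i j h).le
  · exact (G.adj_zero i j h).ge

theorem WeightedGraph.laplacian_mulVec (G : WeightedGraph N) (p : Fin N → ℝ) (i : Fin N) :
    G.laplacian.mulVec p i = ∑ j, G.A i j * (p i - p j) := by
  rw [laplacian, Matrix.sub_mulVec, Pi.sub_apply, Matrix.mulVec_diagonal]
  simp only [Matrix.mulVec, dotProduct, Pi.one_apply, mul_one, mul_sub, Finset.sum_sub_distrib,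
    Finset.sum_mul]

/-- The Dirichlet form of the Laplacian of a symmetric graph. -/
theorem WeightedGraph.sum_sub_mul_laplacian (hsymm : G.IsSymmetric) (p : Fin N → ℝ) (c : ℝ) :
    ∑ i, (p i - c) * G.laplacian.mulVec p i = (∑ i, ∑ j, G.A i j * (p i - p j) ^ 2) / 2 := by
  simp only [G.laplacian_mulVec, Finset.mul_sum]
  have h1 : ∑ i, ∑ j, (p i - c) * (G.A i j * (p i - p j)) =
      ∑ i, ∑ j, (p j - c) * (G.A i j * (p j - p i)) := by
    rw [Finset.sum_comm]
    refine Finset.sum_congr rfl fun i _ => Finset.sum_congr rfl fun j _ => ?_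
    rw [hsymm.apply]
  rw [eq_div_iff two_ne_zero, mul_two]
  -- Adding the index-swapped copy turns `p i - c` into `p i - p j`, so `c` drops out.
  nth_rewrite 2 [h1]
  simp only [← Finset.sum_add_distrib]
  refine Finset.sum_congr rfl fun i _ => Finset.sum_congr rfl fun j _ => ?_
  ring

theorem WeightedGraph.mul_sq_sub_le (G : WeightedGraph N) (p : Fin N → ℝ) (u v : Fin N) :
    G.A u v * (p u - p v) ^ 2 ≤ ∑ i, ∑ j, G.A i j * (p i - p j) ^ 2 := by
  have h : ∀ i j, 0 ≤ G.A i j * (p i - p j) ^ 2 := fun i j =>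
    mul_nonneg (G.adj_nonneg i j) (sq_nonneg _)
  calc G.A u v * (p u - p v) ^ 2 ≤ ∑ j, G.A u j * (p u - p j) ^ 2 :=
        Finset.single_le_sum (f := fun j => G.A u j * (p u - p j) ^ 2) (fun j _ => h u j)
          (Finset.mem_univ v)
    _ ≤ _ := Finset.single_le_sum (f := fun i => ∑ j, G.A i j * (p i - p j) ^ 2)
          (fun i _ => Finset.sum_nonneg fun j _ => h i j) (Finset.mem_univ u)

/-- A Poincaré inequality along a path. -/
theorem WeightedGraph.exists_sq_sub_le_of_path {i j : Fin N}
    (h : Relation.ReflTransGen (fun u v => (u, v) ∈ G.edges ∨ (v, u) ∈ G.edges) i j) :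
    ∃ C : ℝ, 0 ≤ C ∧ ∀ p : Fin N → ℝ,
      (p i - p j) ^ 2 ≤ C * ∑ i, ∑ j, G.A i j * (p i - p j) ^ 2 := by
  induction h with
  | refl => exact ⟨0, le_rfl, fun p => by simp⟩
  | @tail u v _ huv ih =>
    obtain ⟨C, hC, hCp⟩ := ih
    have hedge : ∃ a : ℝ, 0 < a ∧ ∀ p : Fin N → ℝ,
        a * (p u - p v) ^ 2 ≤ ∑ i, ∑ j, G.A i j * (p i - p j) ^ 2 := by
      obtain h | h := huv
      · refine ⟨G.A v u, G.adj_pos v u h, fun p => ?_⟩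
        have := G.mul_sq_sub_le p v u
        rwa [sub_sq_comm] at this
      · exact ⟨G.A u v, G.adj_pos u v h, fun p => G.mul_sq_sub_le p u v⟩
    obtain ⟨a, ha, hap⟩ := hedge
    -- From `(s + t)² ≤ 2 s² + 2 t²`.
    refine ⟨2 * C + 2 * a⁻¹, by positivity, fun p => ?_⟩
    have h1 := hCp p
    have h2 := (le_inv_mul_iff₀ ha).2 (hap p)
    linarith [sq_nonneg ((p i - p u) - (p u - p v))]

theorem WeightedGraph.exists_sq_sub_le (hconn : G.IsConnected) :
    ∃ C : ℝ, 0 < C ∧ ∀ (p : Fin N → ℝ) (i j : Fin N),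
      (p i - p j) ^ 2 ≤ C * ∑ i, ∑ j, G.A i j * (p i - p j) ^ 2 := by
  choose C hC hCp using fun i j => exists_sq_sub_le_of_path (hconn i j)
  have hsum : 0 ≤ ∑ i, ∑ j, C i j := Finset.sum_nonneg fun i _ => Finset.sum_nonneg fun j _ => hC i j
  refine ⟨∑ i, ∑ j, C i j + 1, by positivity, fun p i j => (hCp i j p).trans ?_⟩
  refine mul_le_mul_of_nonneg_right ?_ (Finset.sum_nonneg fun i _ => Finset.sum_nonneg fun j _ =>
    mul_nonneg (G.adj_nonneg i j) (sq_nonneg _))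
  have h1 : C i j ≤ ∑ j, C i j :=
    Finset.single_le_sum (f := fun j => C i j) (fun j _ => hC i j) (Finset.mem_univ j)
  have h2 : ∑ j, C i j ≤ ∑ i, ∑ j, C i j :=
    Finset.single_le_sum (f := fun i => ∑ j, C i j)
      (fun i _ => Finset.sum_nonneg fun j _ => hC i j) (Finset.mem_univ i)
  linarith

/-- The Krasowskii regularization of the quantized field is contained in the image under `-L` of
the product of the intervals spanned by the one-sided limits of the quantizer. -/
theorem exists_of_mem_krasowskii (hΔ : 0 < Δ) {x v : EuclideanSpace ℝ (Fin N)}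
    (hv : v ∈ krasowskii (quantizedField G Δ) x) :
    ∃ p ∈ quantizerBox Δ x, ∀ i, v i = -G.laplacian.mulVec p i := by
  let T : (Fin N → ℝ) →ₗ[ℝ] EuclideanSpace ℝ (Fin N) :=
    (WithLp.linearEquiv 2 ℝ (Fin N → ℝ)).symm.toLinearMap ∘ₗ (-G.laplacian.mulVecLin)
  have hev : ∀ᶠ y in 𝓝 x, (fun i => quantizer Δ (y i)) ∈ quantizerBox Δ x := by
    have : ∀ i, ∀ᶠ y in 𝓝 x,
        quantizer Δ (y i) ∈ Set.Icc (lowerQuantizer Δ (x i)) (quantizer Δ (x i)) := fun i =>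
      (Continuous.tendsto (f := fun y : EuclideanSpace ℝ (Fin N) => y i) (by fun_prop) x).eventually
        (eventually_quantizer_mem_Icc hΔ (x i))
    filter_upwards [eventually_all.2 this] with y hy
    exact ⟨fun i => (hy i).1, fun i => (hy i).2⟩
  obtain ⟨δ, hδ, hball⟩ := Metric.eventually_nhds_iff_ball.1 hev
  have hcompact : IsCompact (T '' quantizerBox Δ x) :=
    isCompact_Icc.image (LinearMap.continuous_of_finiteDimensional T)
  have hsub : closure (convexHull ℝ (quantizedField G Δ '' Metric.ball x δ)) ⊆
      -- One small `δ` suffices, the image of the box being convex and compact.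
      T '' quantizerBox Δ x := by
    refine closure_minimal (convexHull_min ?_ ((convex_Icc _ _).linear_image T)) hcompact.isClosed
    rintro _ ⟨y, hy, rfl⟩
    exact ⟨_, hball y hy, rfl⟩
  obtain ⟨p, hp, rfl⟩ := hsub (Set.mem_iInter₂.1 hv δ hδ)
  exact ⟨p, hp, fun i => rfl⟩

end Graph

/-! ### Decay along solutions and finite-time arrival -/

section Convergence

variable {N : ℕ} {G : WeightedGraph N} {Δ : ℝ} {x : ℝ → EuclideanSpace ℝ (Fin N)}

/-- Along a Krasowskii solution the Lyapunov functions decrease at the rate of the Dirichlet form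
of a selection of the quantized state. -/
theorem ae_exists_deriv_lyapunov (hsymm : G.IsSymmetric) (hΔ : 0 < Δ)
    (hx : IsKrasowskiiSolution (quantizedField G Δ) (Set.Ici 0) x) (k : ℤ) {a b : ℝ} (ha : 0 ≤ a)
    (hab : a ≤ b) :
    ∀ᵐ t, t ∈ Set.Icc a b → ∃ p ∈ quantizerBox Δ (x t),
      deriv (lyapunov Δ k ∘ x) t = -((∑ i, ∑ j, G.A i j * (p i - p j) ^ 2) / 2) := by
  have hac := absolutelyContinuousOnInterval_lyapunov hΔ k
    (hx.absolutelyContinuous a ha b (ha.trans hab))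
  have hinc := (ae_restrict_iff' measurableSet_Ici).1 hx.inclusion
  filter_upwards [hac.ae_differentiableAt, hinc] with t hdiff hincl ht
  obtain ⟨v, hv, hxv⟩ := hincl (ha.trans ht.1)
  obtain ⟨p, hp, hpv⟩ := exists_of_mem_krasowskii hΔ hv
  refine ⟨p, hp, ?_⟩
  have hd := hdiff (by rwa [Set.uIcc_of_le hab])
  let P : EuclideanSpace ℝ (Fin N) →L[ℝ] ℝ := ∑ i, (p i - k * Δ) • EuclideanSpace.proj i
  have hP : ∀ y, P y = ∑ i, (p i - k * Δ) * y i := fun y => by simp [P]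
  rw [deriv_comp_eq_of_subgradient P ?_ hxv hd, hP, ← G.sum_sub_mul_laplacian hsymm p (k * Δ)]
  · simp [hpv]
  · intro y
    rw [hP, lyapunov, lyapunov, ← Finset.sum_add_distrib]
    exact Finset.sum_le_sum fun i _ => potential_add_mul_le hΔ k ⟨hp.1 i, hp.2 i⟩ (y i)

theorem lyapunov_antitone (hsymm : G.IsSymmetric) (hΔ : 0 < Δ)
    (hx : IsKrasowskiiSolution (quantizedField G Δ) (Set.Ici 0) x) (k : ℤ) {a b : ℝ} (ha : 0 ≤ a)
    (hab : a ≤ b) : lyapunov Δ k (x b) ≤ lyapunov Δ k (x a) := by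
  have h := (absolutelyContinuousOnInterval_lyapunov hΔ k
    (hx.absolutelyContinuous a ha b (ha.trans hab))).sub_le_of_ae_deriv_le (c := 0) hab ?_
  · simp only [Function.comp_apply] at h
    linarith
  · filter_upwards [ae_exists_deriv_lyapunov hsymm hΔ hx k ha hab] with t h ht
    obtain ⟨p, -, hp⟩ := h ht
    have : 0 ≤ ∑ i, ∑ j, G.A i j * (p i - p j) ^ 2 :=
      Finset.sum_nonneg fun i _ => Finset.sum_nonneg fun j _ =>
        mul_nonneg (G.adj_nonneg i j) (sq_nonneg _)
    linarith

/-- Every Krasowskii solution reaches the closure of the consensus set in finite time. -/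
theorem exists_time_lyapunov_eq_zero (hsymm : G.IsSymmetric) (hconn : G.IsConnected) (hΔ : 0 < Δ)
    (hx : IsKrasowskiiSolution (quantizedField G Δ) (Set.Ici 0) x) :
    ∃ t, 0 ≤ t ∧ ∃ k : ℤ, lyapunov Δ k (x t) = 0 := by
  by_contra! hcon
  obtain ⟨C, hC, hCp⟩ := G.exists_sq_sub_le hconn
  -- A gap of at least `Δ` makes the Dirichlet sum at least `Δ² / C = 2 c`, and `V_0'` is minus half
  -- of it.
  obtain ⟨c, hc, hcC⟩ : ∃ c : ℝ, 0 < c ∧ C * (2 * c) = Δ ^ 2 :=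
    ⟨Δ ^ 2 / (2 * C), by positivity, by field_simp⟩
  have hdecay : ∀ T, 0 ≤ T → lyapunov Δ 0 (x T) - lyapunov Δ 0 (x 0) ≤ -c * (T - 0) := by
    intro T hT
    refine (absolutelyContinuousOnInterval_lyapunov hΔ 0
      (hx.absolutelyContinuous 0 Set.self_mem_Ici T hT)).sub_le_of_ae_deriv_le hT ?_
    filter_upwards [ae_exists_deriv_lyapunov hsymm hΔ hx 0 le_rfl hT] with t h ht
    obtain ⟨p, hp, hpd⟩ := h ht
    rw [hpd]
    obtain ⟨i, j, hij⟩ : ∃ i j, Δ ≤ p i - p j := by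
      by_contra! hlt
      obtain ⟨k, hk⟩ := exists_forall_abs_sub_le hΔ hp hlt
      exact hcon t ht.1 k ((lyapunov_eq_zero_iff hΔ).2 hk)
    have h1 : Δ ^ 2 ≤ (p i - p j) ^ 2 := pow_le_pow_left₀ hΔ.le hij 2
    have h2 := le_of_mul_le_mul_left (hcC.le.trans (h1.trans (hCp p i j))) hC
    linarith
  have hV := lyapunov_nonneg hΔ 0 (x 0)
  -- By this time the decay would force `V_0 ≤ -1`.
  have h1 := hdecay ((lyapunov Δ 0 (x 0) + 1) / c) (by positivity)
  have h2 := lyapunov_nonneg hΔ 0 (x ((lyapunov Δ 0 (x 0) + 1) / c))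
  have h3 : c * ((lyapunov Δ 0 (x 0) + 1) / c) = lyapunov Δ 0 (x 0) + 1 := by field_simp
  linarith

end Convergence

end QuantizedConsensus

end

theorem mainTheorem3 (N : ℕ) (G : QuantizedConsensus.WeightedGraph N)
    (hsymm : G.IsSymmetric) (hconn : G.IsConnected)
    (Δ : ℝ) (hΔ : 0 < Δ)
    (x : ℝ → EuclideanSpace ℝ (Fin N))
    (hx : QuantizedConsensus.IsKrasowskiiSolution
      (QuantizedConsensus.quantizedField G Δ) (Set.Ici 0) x) :
    Tendsto (fun t => Metric.infDist (x t) (QuantizedConsensus.consensusSet N Δ))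
      atTop (𝓝 0) := by
  open QuantizedConsensus in
  obtain ⟨t₀, ht₀, k, hk⟩ := exists_time_lyapunov_eq_zero hsymm hconn hΔ hx
  -- The distance is exactly zero from `t₀` on.
  refine tendsto_const_nhds.congr' ?_
  filter_upwards [eventually_ge_atTop t₀] with t ht
  have hzero : lyapunov Δ k (x t) = 0 :=
    le_antisymm (hk ▸ lyapunov_antitone hsymm hΔ hx k ht₀ ht) (lyapunov_nonneg hΔ k _)
  rw [← Metric.infDist_closure,
    Metric.infDist_zero_of_mem (mem_closure_consensusSet hΔ ((lyapunov_eq_zero_iff hΔ).1 hzero))]
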